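/- Write $\mathbb{R}$ for Baire space $\omega^\omega$. For $k\in\omega$, $r\in\mathbb{R}$ let $k^\smallfrown r$ be the real with first entry $k$ followed by $r$, and for $F\colon\mathbb{R}\to\omega$ let $F*r\in\mathbb{R}$ be given by $(F*r)(k)=F(k^\smallfrown r)$; pairs $\langle a,b\rangle$ and finite strings of reals are coded by reals in a fixed standard way. Let $\mathcal{B}=(\omega,\mathbb{R},\{F\colon\mathbb{R}\to\omega : F\text{ Borel}\})$ be the $\omega$-model whose type-1 objects are all reals and whose type-2 objects are the Borel functions $\mathbb{R}\to\omega$. A well-ordering of a set of reals in $\mathcal{B}$ is a Borel functional $W\colon\mathbb{R}\to\{0,1,2\}$ such that $W(\langle a,b\rangle)=0$ if $a<_W b$, $1$ if $b\le_W a$, and $2$ if $a,b$ are not both in $\mathrm{dom}(W)$, where $<_W$ is a well-ordering of the set $\mathrm{dom}(W)\subseteq\mathbb{R}$. $\mathsf{CWO}^{\mathbb{R}}$ says: for any two well-orderings $X,Y$ of sets of reals there is a type-2 functional $F$ such that $a\mapsto F*a$ is an order embedding of one of them into the other. A tree is a nonempty set $T\subseteq\mathbb{R}^{<\omega}$ closed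 under initial segments, given by a type-2 functional; a strategy is a map $\mathbb{R}^{<\omega}\to\mathbb{R}$ of the form $\sigma\mapsto S*\sigma$ with $S$ a type-2 functional. For strategies $\Sigma$ (player I, who moves first) and $\Pi$ (player II), let $(\Sigma\otimes\Pi)_k$ be the string of the first $k$ moves. $\Sigma$ is winning for I if for every strategy $\Pi$ there is $k$ with $(\Sigma\otimes\Pi)_{2k+1}\in T$ and $(\Sigma\otimes\Pi)_{2k+2}\notin T$; $\Pi$ is winning for II if for every strategy $\Sigma$ there is $k$ with $(\Sigma\otimes\Pi)_{2k}\in T$ and $(\Sigma\otimes\Pi)_{2k+1}\notin T$. (All strategies range over those of the model.) $\Delta_1^{\mathbb{R}}$-$\mathsf{Det}$ says: for every well-founded tree $T$ one of the players has a winning strategy. Lemma. $\mathcal{B}\models\mathsf{CWO}^{\mathbb{R}}+\neg\,\Delta_1^{\mathbb{R}}\text{-}\mathsf{Det}$. Moreover: (a) every Borel well-ordering of a set of reals has countable domain; (b) the failure of $\Delta_1^{\mathbb{R}}$-$\mathsf{Det}$ is witnessed as follows: there are an analytic set $X\subseteq\mathbb{R}$ which is not Borel and a closed set $C\subseteq\mathbb{R}\times\mathbb{R}$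 whose projection to the first coordinate is $X$, such that the following game is a Borel well-founded tree and neither player has a winning strategy in $\mathcal{B}$: player I plays a real $a$; player II plays a real $c$, guessing that $a\in X$ if $c(0)\neq 0$ and that $a\notin X$ if $c(0)=0$; then, if II guessed $a\notin X$, player I plays a real $b$ and wins iff $(a,b)\in C$, and if II guessed $a\in X$, player I makes an irrelevant move, after which II plays a real $b$ and wins iff $(a,b)\in C$. -/

import Mathlib

noncomputable section

namespace HigherRM

/-- The reals, taken (as usual in this subject) to be the functions from `ℕ` to `ℕ`, i.e. Baire
space. It carries Mathlib's product topology and product (equivalently Borel) sigma-algebra. -/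
abbrev Baire : Type := ℕ → ℕ

/-- `k ⌢ r`: the real with first entry `k`, followed by `r`. -/
def concat (k : ℕ) (r : Baire) : Baire
  | 0 => k
  | n + 1 => r n

/-- The operation `F * r`, given by `(F * r)(k) = F (k ⌢ r)`. It turns a type-2 functional into a map
from reals to reals. -/
def starMap (F : Baire → ℕ) (r : Baire) : Baire := fun k => F (concat k r)

/-- Pairing of reals, pointwise. -/
def pair (x y : Baire) : Baire := fun n => Nat.pair (x n) (y n)

/-- A (full) omega-model `(ω, ℝ, M₂)`: the objects of type 0 are the natural numbers, those of type 1
are all reals, and those of type 2 are the members of the given set of functionals `ℝ → ω`. The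
operations of the language have their standard meaning, so the model is determined by this set. -/
structure OmegaModel where
  functionals : Set (Baire → ℕ)

/-- The model whose type-2 objects are the Borel functions `ℝ → ω`. -/
def borelModel : OmegaModel := ⟨{F | Measurable F}⟩

/-! ### Well-orderings of sets of reals -/

/-- The domain of the relation coded by `W`. -/
def dom (W : Baire → ℕ) : Set Baire := {a | W (pair a a) ≠ 2}

/-- `W` codes a well-ordering of the set of reals `dom W`: it takes only the values `0, 1, 2`;
`W ⟨a, b⟩ = 2` if and only if `a, b` are not both in the domain; and `a <_W b`, i.e. `W ⟨a, b⟩ = 0`, is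
a (strict) well-ordering of the domain. So, for `a, b` in the domain, `W ⟨a, b⟩ = 1` iff `b ≤_W a`. -/
structure IsWellOrdering (W : Baire → ℕ) : Prop where
  lt_three : ∀ x, W x < 3
  eq_two_iff : ∀ a b, W (pair a b) = 2 ↔ ¬ (a ∈ dom W ∧ b ∈ dom W)
  wellOrder : IsWellOrder (dom W) (fun a b => W (pair a b) = 0)

/-- The functional `F`, acting on reals by `a ↦ F * a`, is an embedding of the ordering coded by `X`
into the one coded by `Y`. -/
def IsEmbedding (F X Y : Baire → ℕ) : Prop :=
  (∀ a ∈ dom X, starMap F a ∈ dom Y) ∧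
    ∀ a ∈ dom X, ∀ b ∈ dom X, X (pair a b) = 0 ↔ Y (pair (starMap F a) (starMap F b)) = 0

/-- `M` satisfies the comparability of well-orderings of sets of reals. -/
def OmegaModel.CWO (M : OmegaModel) : Prop :=
  ∀ X ∈ M.functionals, ∀ Y ∈ M.functionals, IsWellOrdering X → IsWellOrdering Y →
    ∃ F ∈ M.functionals, IsEmbedding F X Y ∨ IsEmbedding F Y X

/-! ### Clopen games on reals -/

/-- Finite strings of reals are coded by reals: the first entry is the length of the string, the
entry number `1 + ⟨i, n⟩` is the `n`-th entry of the `i`-th term of the string (`0` if there is no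
such term). -/
def code (σ : List Baire) : Baire
  | 0 => σ.length
  | m + 1 => σ.getD m.unpair.1 0 m.unpair.2

/-- The set of strings coded by a type-2 functional. -/
def strings (T : Baire → ℕ) : Set (List Baire) := {σ | T (code σ) = 1}

/-- The canonical type-2 functional coding a set of strings: the characteristic function of the set
of codes. -/
def charFun (T : Set (List Baire)) : Baire → ℕ := (code '' T).indicator 1

/-- A (nonempty) tree of finite strings of reals. -/
def IsTree (T : Set (List Baire)) : Prop :=
  [] ∈ T ∧ ∀ (σ : List Baire) (a : Baire), σ ++ [a] ∈ T → σ ∈ T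

/-- A tree is well-founded if it has no infinite path. -/
def IsWellFounded (T : Set (List Baire)) : Prop :=
  ¬ ∃ f : ℕ → Baire, ∀ k : ℕ, (List.range k).map f ∈ T

/-- The strategy coded by a functional `S`: it maps a finite string of reals `σ` to the
real `S * code σ`. -/
def strategy (S : Baire → ℕ) (σ : List Baire) : Baire := starMap S (code σ)

/-- The first `k` moves `(S ⊗ P)_k` of the play in which player I uses `S` and player II uses `P`.
Player I moves first. -/
def play (S P : List Baire → Baire) : ℕ → List Baire
  | 0 => []
  | k + 1 => play S P k ++ [if Even k then S (play S P k) else P (play S P k)]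

/-- In `M`, player I has a winning strategy in the game on `T`, where the first player who leaves the
tree loses. -/
def OmegaModel.WinI (M : OmegaModel) (T : Set (List Baire)) : Prop :=
  ∃ S ∈ M.functionals, ∀ P ∈ M.functionals, ∃ k : ℕ,
    play (strategy S) (strategy P) (2 * k + 1) ∈ T ∧
      play (strategy S) (strategy P) (2 * k + 2) ∉ T

/-- In `M`, player II has a winning strategy in the game on `T`. -/
def OmegaModel.WinII (M : OmegaModel) (T : Set (List Baire)) : Prop :=
  ∃ P ∈ M.functionals, ∀ S ∈ M.functionals, ∃ k : ℕ,
    play (strategy S) (strategy P) (2 * k) ∈ T ∧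
      play (strategy S) (strategy P) (2 * k + 1) ∉ T

/-- `M` satisfies clopen determinacy for reals. -/
def OmegaModel.ClopenDet (M : OmegaModel) : Prop :=
  ∀ T ∈ M.functionals, IsTree (strings T) → IsWellFounded (strings T) →
    M.WinI (strings T) ∨ M.WinII (strings T)

/-- The guessing game of a set `C` of pairs of reals, as a tree. Player I plays a real `a`; player II
plays `c` and thereby guesses whether `a` is in the projection of `C` (`c 0 = 0` means no, `c 0 ≠ 0`
means yes). After "no", player I plays `b` and wins iff `(a, b) ∈ C`. After "yes", player I makes
an irrelevant move, and then player II plays `b` and wins iff `(a, b) ∈ C`. -/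
def guessingGame (C : Set (Baire × Baire)) : Set (List Baire) :=
  {σ | match σ with
    | [] => True
    | [_] => True
    | [_, _] => True
    | [a, c, b] => c 0 = 0 → (a, b) ∈ C
    | [a, c, _, b] => c 0 ≠ 0 ∧ (a, b) ∈ C
    | _ => False}

end HigherRM

end

open HigherRM

/-! Sierpiński's Fubini argument shows that an atomless measure vanishes if the space has a
measurable well-ordering. Since an uncountable standard Borel space carries a copy of Lebesgue
measure, Borel well-orderings have countable domain. Any map defined on a countable set of reals is
given by a Borel functional, so the usual initial-segment comparison stays inside the model. For
determinacy, a Borel winning strategy for II in the guessing game would decide membership in the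
projection of `C` in a Borel way, which is impossible if that projection is not Borel. A strategy
for I begins with a fixed real `a`, so a suitable opponent simply makes the correct guess about `a`.
-/

namespace HigherRM

open MeasureTheory Set

/-! ### Measurable well-orderings are countable -/

/-- If almost all initial segments of a measurable well-ordering are null, then so is the whole
space. -/
theorem measure_eq_zero_of_ae_initialSegment_null {α : Type*} [MeasurableSpace α]
    (ν : Measure α) [SFinite ν] [NullSingletonClass ν] (r : α → α → Prop) [Std.Trichotomous r]
    (hr : MeasurableSet {p : α × α | r p.1 p.2}) (h : ∀ᵐ y ∂ν, ν {x | r x y} = 0) : ν = 0 := by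
  -- Fubini: the section over `y` is the initial segment below `y`, null for almost all `y`. By the
  -- swap symmetry of `ν.prod ν`, almost all final segments are null as well.
  have hnull : (ν.prod ν) {p : α × α | r p.2 p.1} = 0 := by
    refine (Measure.measure_prod_null (measurable_swap hr)).2 ?_
    filter_upwards [h] with y hy using hy
  have hnull' : (ν.prod ν) {p : α × α | r p.1 p.2} = 0 := by
    rw [← Measure.prod_swap, Measure.map_apply measurable_swap hr]
    exact hnull
  have hae := Measure.measure_ae_null_of_prod_null hnull'
  by_contra hν
  have : (ae ν).NeBot := ae_neBot.2 hν
  obtain ⟨x, hx, hx'⟩ := (h.and hae).exists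
  refine hν (Measure.measure_univ_eq_zero.1 ?_)
  have hcover : (univ : Set α) ⊆ {z | r z x} ∪ ({x} ∪ {z | r x z}) := by
    intro z _
    rcases trichotomous_of r z x with hz | hz | hz
    · exact Or.inl hz
    · exact Or.inr (Or.inl hz)
    · exact Or.inr (Or.inr hz)
  exact measure_mono_null hcover
    (measure_union_null hx (measure_union_null (measure_singleton x) hx'))

/-- An atomless measure for which some well-ordering of the space is measurable is zero
(Sierpiński). -/
theorem measure_eq_zero_of_measurable_wellOrder {α : Type*} [MeasurableSpace α]
    (μ : Measure α) [SFinite μ] [NullSingletonClass μ] (r : α → α → Prop) [IsWellOrder α r]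
    (hr : MeasurableSet {p : α × α | r p.1 p.2}) : μ = 0 := by
  by_cases hpos : ∃ y, μ {x | r x y} ≠ 0
  -- At the least `y` with non-null initial segment, `μ` restricted to that segment satisfies the
  -- previous lemma by minimality.
  · obtain ⟨y, hy, hmin⟩ := (IsWellFounded.wf (r := r)).has_min {y | μ {x | r x y} ≠ 0} hpos
    have hmeas : MeasurableSet {x | r x y} := measurable_prodMk_right hr
    refine absurd (Measure.restrict_eq_zero.1 ?_) hy
    refine measure_eq_zero_of_ae_initialSegment_null (μ.restrict {x | r x y}) r hr ?_
    refine (ae_restrict_iff' hmeas).2 (Filter.Eventually.of_forall fun z hz => ?_)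
    have hz0 : μ {x | r x z} = 0 := by
      by_contra hne
      exact hmin z hne hz
    exact le_antisymm ((Measure.restrict_apply_le _ _).trans hz0.le) zero_le
  · push Not at hpos
    exact measure_eq_zero_of_ae_initialSegment_null μ r hr (Filter.Eventually.of_forall hpos)

/-- A standard Borel space with a measurable well-ordering is countable. -/
theorem countable_of_measurable_wellOrder {α : Type*} [MeasurableSpace α] [StandardBorelSpace α]
    (r : α → α → Prop) [IsWellOrder α r] (hr : MeasurableSet {p : α × α | r p.1 p.2}) :
    Countable α := by
  by_contra hα
  have hℝ : ¬ Countable ℝ := not_countable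
  let e : ℝ ≃ᵐ α := PolishSpace.measurableEquivOfNotCountable hℝ hα
  have : IsWellOrder ℝ (e ⁻¹'o r) := (RelIso.preimage e.toEquiv r).toRelEmbedding.isWellOrder
  have hvol := measure_eq_zero_of_measurable_wellOrder (volume : Measure ℝ) (e ⁻¹'o r)
    ((e.measurable.prodMap e.measurable) hr)
  simpa using congrArg (fun μ : Measure ℝ => μ univ) hvol

theorem continuous_pair : Continuous fun p : Baire × Baire => pair p.1 p.2 := by
  refine continuous_pi fun n => ?_
  have h : Continuous fun p : Baire × Baire => (p.1 n, p.2 n) := by fun_prop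
  exact (continuous_of_discreteTopology (f := fun q : ℕ × ℕ => Nat.pair q.1 q.2)).comp h

theorem measurableSet_dom {W : Baire → ℕ} (hW : Measurable W) : MeasurableSet (dom W) := by
  have h : Measurable fun a : Baire => W (pair a a) :=
    hW.comp (continuous_pair.comp (continuous_id.prodMk continuous_id)).measurable
  exact h (MeasurableSet.of_discrete (s := {2}ᶜ))

theorem IsWellOrdering.countable_dom {W : Baire → ℕ} (h : IsWellOrdering W) (hW : Measurable W) :
    (dom W).Countable := by
  have := h.wellOrder
  have := (measurableSet_dom hW).standardBorel
  refine countable_coe_iff.1 (countable_of_measurable_wellOrder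
    (fun a b : dom W => W (pair a b) = 0) ?_)
  have hm : Measurable fun p : dom W × dom W => W (pair p.1 p.2) :=
    (hW.comp continuous_pair.measurable).comp
      (measurable_subtype_coe.prodMap measurable_subtype_coe)
  exact hm (MeasurableSet.of_discrete (s := {0}))

/-! ### Comparability -/

theorem concat_zero_tail (x : Baire) : concat (x 0) (fun n => x (n + 1)) = x := by
  funext n
  cases n <;> rfl

theorem measurable_concat (k : ℕ) : Measurable (concat k) := by
  refine measurable_pi_lambda _ fun n => ?_
  cases n with
  | zero => exact measurable_const
  | succ n => exact measurable_pi_apply n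

/-- Every map from a countable set of reals to the reals is induced by a Borel functional. -/
theorem exists_measurable_starMap_eq {D : Set Baire} (hD : D.Countable) (f : Baire → Baire) :
    ∃ F : Baire → ℕ, Measurable F ∧ ∀ a ∈ D, starMap F a = f a := by
  classical
  refine ⟨fun x => if (fun n => x (n + 1)) ∈ D then f (fun n => x (n + 1)) (x 0) else 0, ?_, ?_⟩
  -- The functional is nonzero only at reals `k ⌢ a` with `a ∈ D`, which form a countable set.
  · refine Measurable.measurable_of_countable_ne (measurable_const (a := 0)) ?_
    refine Set.Countable.mono ?_
      ((countable_univ (α := ℕ)).image2 hD concat)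
    intro x hx
    by_cases hxD : (fun n => x (n + 1)) ∈ D
    · exact ⟨x 0, mem_univ _, _, hxD, concat_zero_tail x⟩
    · exact absurd (by simp [hxD]) hx
  · intro a ha
    funext k
    have : (fun n => concat k a (n + 1)) = a := rfl
    simp only [starMap, this, ha, if_true]
    rfl

/-- An order embedding between countable well-orderings is induced by a Borel functional. -/
theorem exists_isEmbedding_of_relEmbedding {X Y : Baire → ℕ} (hX : (dom X).Countable)
    (f : (fun a b : dom X => X (pair a b) = 0) ↪r (fun a b : dom Y => Y (pair a b) = 0)) :
    ∃ F ∈ borelModel.functionals, IsEmbedding F X Y := by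
  classical
  obtain ⟨F, hF, hFf⟩ := exists_measurable_starMap_eq hX
    (fun a => if h : a ∈ dom X then (f ⟨a, h⟩ : Baire) else 0)
  have hval : ∀ a (h : a ∈ dom X), starMap F a = f ⟨a, h⟩ := fun a h => by simp [hFf a h, h]
  refine ⟨F, hF, fun a ha => hval a ha ▸ (f ⟨a, ha⟩).2, fun a ha b hb => ?_⟩
  rw [hval a ha, hval b hb]
  exact (f.map_rel_iff (a := ⟨a, ha⟩) (b := ⟨b, hb⟩)).symm

theorem borelModel_cwo : borelModel.CWO := by
  intro X hX Y hY hWX hWY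
  have := hWX.wellOrder
  have := hWY.wellOrder
  rcases InitialSeg.total (fun a b : dom X => X (pair a b) = 0)
      (fun a b : dom Y => Y (pair a b) = 0) with f | f
  · obtain ⟨F, hF, hE⟩ := exists_isEmbedding_of_relEmbedding (hWX.countable_dom hX) f.toRelEmbedding
    exact ⟨F, hF, Or.inl hE⟩
  · obtain ⟨F, hF, hE⟩ := exists_isEmbedding_of_relEmbedding (hWY.countable_dom hY) f.toRelEmbedding
    exact ⟨F, hF, Or.inr hE⟩

/-! ### A non-Borel analytic set -/

/-- The number coding the restriction of a real to `n`. -/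
def initialCode (z : Baire) (n : ℕ) : ℕ := Nat.pair n (Encodable.encode fun i : Fin n => z i)

theorem initialCode_eq_iff {z w : Baire} {n m : ℕ} :
    initialCode z n = initialCode w m ↔ n = m ∧ ∀ i < n, z i = w i := by
  constructor
  · intro h
    obtain ⟨rfl, h⟩ := Nat.pair_eq_pair.1 h
    exact ⟨rfl, fun i hi => congrFun (Encodable.encode_injective h) ⟨i, hi⟩⟩
  · rintro ⟨rfl, h⟩
    have : (fun i : Fin n => z i) = fun i : Fin n => w i := funext fun i => h i i.2
    rw [initialCode, initialCode, this]

theorem continuous_initialCode (n : ℕ) : Continuous fun z : Baire => initialCode z n := by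
  have h : Continuous fun (z : Baire) (i : Fin n) => z i := by fun_prop
  exact (continuous_of_discreteTopology
    (f := fun s : Fin n → ℕ => Nat.pair n (Encodable.encode s))).comp h

/-- Every closed set of reals is coded by a real. -/
theorem _root_.IsClosed.exists_code {F : Set Baire} (hF : IsClosed F) :
    ∃ x : Baire, ∀ z, z ∈ F ↔ ∀ n, x (initialCode z n) = 0 := by
  classical
  -- The code vanishes exactly at the initial segments of members of `F`; a real all of whose
  -- initial segments are such lies in the closure of `F`.
  refine ⟨fun m => if ∃ w ∈ F, ∃ n, m = initialCode w n then 0 else 1, fun z => ⟨?_, ?_⟩⟩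
  · intro hz n
    exact if_pos ⟨z, hz, n, rfl⟩
  · intro h
    rw [← hF.closure_eq, (PiNat.isTopologicalBasis_cylinders fun _ => ℕ).mem_closure_iff]
    rintro _ ⟨y, n, rfl⟩ hz
    have hn := h n
    simp only [ite_eq_left_iff, one_ne_zero, imp_false, not_not] at hn
    obtain ⟨w, hw, m, hm⟩ := hn
    obtain ⟨rfl, hzw⟩ := initialCode_eq_iff.1 hm
    exact ⟨w, fun i hi => (hzw i hi).symm.trans (hz i hi), hw⟩

/-- A Borel set of reals is the projection of a closed set. -/
theorem exists_closed_pair_of_measurableSet {s : Set Baire} (hs : MeasurableSet s) :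
    ∃ F : Set Baire, IsClosed F ∧ ∀ a, a ∈ s ↔ ∃ b, pair a b ∈ F := by
  have hs' := hs.analyticSet
  rw [AnalyticSet] at hs'
  rcases hs' with rfl | ⟨f, hf, rfl⟩
  · exact ⟨∅, isClosed_empty, fun a => by simp⟩
  · have hu (g : ℕ → ℕ) : Continuous fun (z : Baire) (n : ℕ) => g (z n) :=
      continuous_pi fun n =>
        (continuous_of_discreteTopology (f := g)).comp (continuous_apply n)
    refine ⟨{z | f (fun n => (z n).unpair.2) = fun n => (z n).unpair.1},
      isClosed_eq (hf.comp (hu fun m => m.unpair.2)) (hu fun m => m.unpair.1), fun a => ?_⟩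
    simp [pair]

/-- A closed set whose projection is not Borel, obtained by diagonalization. -/
def diagonalClosed : Set (Baire × Baire) :=
  {p | ∀ n, p.1 (initialCode (pair p.1 p.2) n) = 0}

theorem isClosed_diagonalClosed : IsClosed diagonalClosed := by
  have h : diagonalClosed = ⋂ (n : ℕ) (m : ℕ),
      {p : Baire × Baire | initialCode (pair p.1 p.2) n = m → p.1 m = 0} := by
    ext p
    simp [diagonalClosed]
  rw [h]
  refine isClosed_iInter fun n => isClosed_iInter fun m => ?_
  have hc : Continuous fun p : Baire × Baire => (initialCode (pair p.1 p.2) n, p.1 m) :=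
    ((continuous_initialCode n).comp continuous_pair).prodMk
      ((continuous_apply m).comp continuous_fst)
  exact (isClosed_discrete {q : ℕ × ℕ | q.1 = m → q.2 = 0}).preimage hc

/-- Otherwise the complement would be the projection of a closed set with some code `x`, and then
`x` would lie in the projection of `diagonalClosed` iff it does not. -/
theorem not_measurableSet_fst_diagonalClosed :
    ¬ MeasurableSet (Prod.fst '' diagonalClosed) := by
  intro h
  obtain ⟨F, hF, hsF⟩ := exists_closed_pair_of_measurableSet h.compl
  obtain ⟨x, hx⟩ := hF.exists_code
  have h1 : x ∈ Prod.fst '' diagonalClosed ↔ ∃ b, pair x b ∈ F := by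
    simp [diagonalClosed, hx]
  exact iff_not_self (h1.trans (hsF x).symm)

theorem analyticSet_fst_image {C : Set (Baire × Baire)} (hC : IsClosed C) :
    AnalyticSet (Prod.fst '' C) :=
  hC.measurableSet.analyticSet.image_of_continuous continuous_fst

/-! ### Coding strings of reals -/

theorem code_injective : Function.Injective code := by
  intro σ τ h
  have hlen : σ.length = τ.length := congrFun h 0
  refine List.ext_getElem hlen fun i h₁ h₂ => ?_
  funext n
  have := congrFun h (Nat.pair i n + 1)
  simpa [code, h₁, h₂] using this

theorem strings_charFun (T : Set (List Baire)) : strings (charFun T) = T := by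
  classical
  ext σ
  by_cases h : σ ∈ T <;> simp [strings, charFun, indicator_apply, code_injective.eq_iff, h]

theorem measurable_code_ofFn (n : ℕ) : Measurable fun v : Fin n → Baire => code (List.ofFn v) := by
  refine measurable_pi_lambda _ fun m => ?_
  cases m with
  | zero => simp [code]
  | succ m =>
    by_cases h : m.unpair.1 < n
    · simp only [code, List.getD_eq_getElem?_getD, List.getElem?_ofFn, h, dif_pos,
        Option.getD_some]
      exact (measurable_pi_apply _).comp (measurable_pi_apply _)
    · simp [code, h]

/-- The set of codes of the elements of a set of strings is Borel if for all `n` the set has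
Borel many strings of length `n`. -/
theorem measurable_charFun {T : Set (List Baire)}
    (hT : ∀ n, MeasurableSet {v : Fin n → Baire | List.ofFn v ∈ T}) : Measurable (charFun T) := by
  refine measurable_one.indicator ?_
  have h : code '' T = ⋃ n, (fun v : Fin n → Baire => code (List.ofFn v)) ''
      {v | List.ofFn v ∈ T} := by
    ext x
    simp only [mem_image, mem_iUnion, mem_ofPred_eq]
    constructor
    · rintro ⟨σ, hσ, rfl⟩
      exact ⟨σ.length, σ.get, by simpa using hσ, by simp⟩
    · rintro ⟨n, v, hv, rfl⟩
      exact ⟨_, hv, rfl⟩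
  rw [h]
  -- Lusin–Souslin: injective Borel images of Borel sets are Borel.
  exact MeasurableSet.iUnion fun n => (hT n).image_of_measurable_injOn (measurable_code_ofFn n)
    (code_injective.comp List.ofFn_injective).injOn

/-! ### The guessing game -/

theorem isTree_guessingGame (C : Set (Baire × Baire)) : IsTree (guessingGame C) := by
  refine ⟨trivial, fun σ a h => ?_⟩
  match σ with
  | [] | [_] | [_, _] => trivial
  | [_, _, _] => exact fun h0 => absurd h0 h.1
  | _ :: _ :: _ :: _ :: _ => simp [guessingGame] at h

theorem length_le_of_mem_guessingGame {C : Set (Baire × Baire)} {σ : List Baire}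
    (h : σ ∈ guessingGame C) : σ.length ≤ 4 := by
  match σ with
  | [] | [_] | [_, _] | [_, _, _] | [_, _, _, _] => simp
  | _ :: _ :: _ :: _ :: _ :: _ => simp [guessingGame] at h

theorem isWellFounded_guessingGame (C : Set (Baire × Baire)) :
    HigherRM.IsWellFounded (guessingGame C) := by
  rintro ⟨f, hf⟩
  simpa using length_le_of_mem_guessingGame (hf 5)

theorem measurable_charFun_guessingGame {C : Set (Baire × Baire)} (hC : MeasurableSet C) :
    Measurable (charFun (guessingGame C)) := by
  refine measurable_charFun fun n => ?_
  have hz {m : ℕ} (i : Fin m) : MeasurableSet {v : Fin m → Baire | v i 0 = 0} :=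
    ((measurable_pi_apply 0).comp (measurable_pi_apply i)) (MeasurableSet.of_discrete (s := {0}))
  have hp {m : ℕ} (i j : Fin m) : MeasurableSet {v : Fin m → Baire | (v i, v j) ∈ C} :=
    ((measurable_pi_apply i).prodMk (measurable_pi_apply j)) hC
  match n with
  | 0 => exact .const True
  | 1 => exact .const True
  | 2 => exact .const True
  | 3 => exact (hz 1).imp (hp 0 2)
  | 4 => exact (hz 1).compl.inter (hp 0 3)
  | n + 5 =>
    convert MeasurableSet.empty
    refine eq_empty_of_forall_notMem fun v hv => ?_
    have := length_le_of_mem_guessingGame hv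
    rw [List.length_ofFn] at this
    omega

theorem length_play (S P : List Baire → Baire) (k : ℕ) : (play S P k).length = k := by
  induction k with
  | zero => rfl
  | succ k ih => simp [play, ih]

theorem not_play_mem_guessingGame {C : Set (Baire × Baire)} {S P : List Baire → Baire} {k : ℕ}
    (hk : 4 < k) : play S P k ∉ guessingGame C := fun h =>
  hk.not_ge (length_play S P k ▸ length_le_of_mem_guessingGame h)

/-- Strategies that depend only on the length of the position are in the Borel model. -/
theorem exists_strategy_eq_length (f : ℕ → Baire) :
    ∃ S ∈ borelModel.functionals, ∀ σ, strategy S σ = f σ.length := by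
  -- At `k ⌢ code σ`, entry 0 is the argument `k` and entry 1 is the length of `σ`.
  refine ⟨fun x => f (x 1) (x 0), ?_, fun σ => rfl⟩
  exact (Measurable.of_discrete (f := fun q : ℕ × ℕ => f q.1 q.2)).comp
    ((measurable_pi_apply (X := fun _ : ℕ => ℕ) 1).prodMk (measurable_pi_apply 0))

theorem not_winI_guessingGame (C : Set (Baire × Baire)) : ¬ borelModel.WinI (guessingGame C) := by
  rintro ⟨S, -, hS⟩
  by_cases ha : ∃ b, (strategy S [], b) ∈ C
  · obtain ⟨b, hb⟩ := ha
    -- II guesses "yes" at length 1 and plays the witness `b` at length 3.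
    obtain ⟨P, hP, hPf⟩ := exists_strategy_eq_length fun n => if n = 1 then 1 else b
    obtain ⟨k, h1, h2⟩ := hS P hP
    match k with
    | 0 => exact h2 trivial
    | 1 => exact h2 (by simpa [play, guessingGame, hPf, parity_simps] using hb)
    | k + 2 => exact not_play_mem_guessingGame (by omega) h1
  · obtain ⟨P, hP, hPf⟩ := exists_strategy_eq_length fun _ => 0
    obtain ⟨k, h1, h2⟩ := hS P hP
    match k with
    | 0 => exact h2 trivial
    | 1 => exact ha ⟨_, by simpa [play, guessingGame, hPf, parity_simps] using h1⟩
    | k + 2 => exact not_play_mem_guessingGame (by omega) h1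

theorem not_winII_guessingGame {C : Set (Baire × Baire)} (hC : ¬ MeasurableSet (Prod.fst '' C)) :
    ¬ borelModel.WinII (guessingGame C) := by
  rintro ⟨P, hPm, hP⟩
  refine hC ?_
  -- The guesses of a winning `P` must all be correct: a wrong "no" loses to a witness `b` played by
  -- I, and after a "yes" II can only win by producing a witness.
  have hX : Prod.fst '' C = {a : Baire | strategy P [a] 0 ≠ 0} := by
    ext a
    by_cases hc : strategy P [a] 0 = 0
    · refine iff_of_false ?_ (not_not_intro hc)
      rintro ⟨⟨a', b⟩, hb, h⟩
      rw [show a' = a from h] at hb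
      obtain ⟨S, hS, hSf⟩ := exists_strategy_eq_length fun n => if n = 0 then a else b
      obtain ⟨k, h1, h2⟩ := hP S hS
      match k with
      | 0 => exact h2 trivial
      | 1 => exact h2 (by simpa [play, guessingGame, hSf, parity_simps] using fun _ => hb)
      | 2 =>
        simp [play, guessingGame, hSf, parity_simps, hc] at h1
      | k + 3 => exact not_play_mem_guessingGame (by omega) h1
    · refine iff_of_true ?_ hc
      obtain ⟨S, hS, hSf⟩ := exists_strategy_eq_length fun _ => a
      obtain ⟨k, h1, h2⟩ := hP S hS
      match k with
      | 0 => exact absurd trivial h2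
      | 1 => exact absurd (by simp [play, guessingGame, hSf, parity_simps, hc]) h2
      | 2 =>
        simp [play, guessingGame, hSf, parity_simps, hc] at h1
        exact ⟨_, h1, rfl⟩
      | k + 3 => exact absurd h1 (not_play_mem_guessingGame (by omega))
  rw [hX]
  -- The guess is a Borel function of `a`, so the projection would be Borel.
  have hm : Measurable fun a : Baire => strategy P [a] 0 :=
    Measurable.comp hPm ((measurable_concat 0).comp
      ((measurable_code_ofFn 1).comp (measurable_pi_lambda (fun a _ => a) fun _ => measurable_id)))
  exact hm (MeasurableSet.of_discrete (s := {0}ᶜ))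

theorem not_clopenDet_of_not_win {T : Set (List Baire)} (hm : charFun T ∈ borelModel.functionals)
    (hT : IsTree T) (hw : HigherRM.IsWellFounded T) (hI : ¬ borelModel.WinI T)
    (hII : ¬ borelModel.WinII T) : ¬ borelModel.ClopenDet := by
  intro h
  have := h _ hm
  rw [strings_charFun] at this
  exact (this hT hw).elim hI hII

end HigherRM

theorem mainTheorem5 :
    -- the model of Borel functionals satisfies comparability of well-orderings of sets of reals,
    borelModel.CWO ∧
    -- indeed all its well-orderings of sets of reals are countable;
    (∀ W ∈ borelModel.functionals, IsWellOrdering W → (dom W).Countable) ∧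
    -- it does not satisfy clopen determinacy for reals,
    ¬ borelModel.ClopenDet ∧
    -- as witnessed by the guessing game of a non-Borel analytic set.
    (∃ X : Set Baire, MeasureTheory.AnalyticSet X ∧ ¬ MeasurableSet X ∧
      ∃ C : Set (Baire × Baire), IsClosed C ∧ Prod.fst '' C = X ∧
        charFun (guessingGame C) ∈ borelModel.functionals ∧
        strings (charFun (guessingGame C)) = guessingGame C ∧
        IsTree (guessingGame C) ∧ IsWellFounded (guessingGame C) ∧
        ¬ borelModel.WinI (guessingGame C) ∧ ¬ borelModel.WinII (guessingGame C)) := by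
  have hC := isClosed_diagonalClosed
  have hm := measurable_charFun_guessingGame hC.measurableSet
  have hT := isTree_guessingGame diagonalClosed
  have hw := isWellFounded_guessingGame diagonalClosed
  have hI := not_winI_guessingGame diagonalClosed
  have hII := not_winII_guessingGame not_measurableSet_fst_diagonalClosed
  exact ⟨borelModel_cwo, fun W hW h => h.countable_dom hW,
    not_clopenDet_of_not_win hm hT hw hI hII, _, analyticSet_fst_image hC,
    not_measurableSet_fst_diagonalClosed, _, hC, rfl, hm, strings_charFun _, hT, hw, hI, hII⟩
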